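/- Let $M$ be a connected smooth manifold (finite-dimensional, Hausdorff, paracompact, without boundary) and let $\nabla$ be a smooth connection on $TM$. Let $W\subseteq T^*M\otimes T^*M$ be the bundle of symmetric covariant two-tensors, with the connection induced by $\nabla$ and its curvature $R(X,Y)=\nabla_X\nabla_Y-\nabla_Y\nabla_X-\nabla_{[X,Y]}$. For a subset $V\subseteq W$ that meets each fibre in a linear subspace, let $\mathcal S(V)$ be the set of all $v\in V$ through which there is a smooth local section of $W$ with values in $V$. For $W'\subseteq W$ with $\mathcal S(W')=W'$, let $\alpha_{W'}:W'\to (W/W')\otimes T^*M$ be the second fundamental $1$-form: $\alpha_{W'}(w)$ is the class of $\nabla X$ at $x$, where $X$ is any smooth local section with values in $W'$ and $X(x)=w$. Put $W^{(0)}=\mathcal S(\{w\in W: R(\cdot,\cdot)w=0\})$, $W^{(i+1)}=\mathcal S(\ker\alpha_{W^{(i)}})$, and let $\widetilde W=\bigcap_i W^{(i)}$ be the terminal term of this decreasing flag. The connection $\nabla$ is regular if $\widetilde W$ is a smooth vector subbundle of $W$; it is locally metric if each point has an open neighbourhood carrying a smooth Riemannian metric that is parallel for $\nabla$; and it is metric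 if there is a parallel smooth Riemannian metric on all of $M$. Theorem. Suppose that $\nabla$ is regular and locally metric and that $\operatorname{rank}\widetilde W=1$. Then there is a global smooth section $s$ of $\widetilde W$ all of whose values are positive-definite. For each such $s$ there is a unique smooth $1$-form $\Phi$ on $M$ with $\nabla s=s\otimes\Phi$; it is closed, and its class $[\Phi]\in H^1_{\mathrm{dR}}(M)$ does not depend on the choice of $s$. Moreover, $\nabla$ is metric if and only if $[\Phi]=0$ in $H^1_{\mathrm{dR}}(M)$. -/

import Mathlib

open scoped Manifold ContDiff
open Bundle

noncomputable section

namespace MetricConnection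

/-! Throughout, `M` is a smooth manifold modelled on the finite-dimensional real vector space `E`,
and an (affine) connection on `M` is a covariant derivative on its tangent bundle. -/

section Tensors

/-- The fibre at `x` of `T*M ⊗ T*M`: bilinear forms on the tangent space. -/
abbrev Bil (E : Type*) [NormedAddCommGroup E] [NormedSpace ℝ E]
    {M : Type*} [TopologicalSpace M] [ChartedSpace E M] (x : M) : Type _ :=
  TangentSpace 𝓘(ℝ, E) x →L[ℝ] TangentSpace 𝓘(ℝ, E) x →L[ℝ] ℝ

variable {E : Type*} [NormedAddCommGroup E] [NormedSpace ℝ E]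
  {M : Type*} [TopologicalSpace M] [ChartedSpace E M] [IsManifold 𝓘(ℝ, E) ∞ M]

/-- `h` is a smooth section of `T*M ⊗ T*M` over `U`. -/
def SmoothOn (h : Π x : M, Bil E x) (U : Set M) : Prop :=
  ContMDiffOn 𝓘(ℝ, E) (𝓘(ℝ, E).prod 𝓘(ℝ, E →L[ℝ] E →L[ℝ] ℝ)) ∞
    (fun x ↦ TotalSpace.mk' (E →L[ℝ] E →L[ℝ] ℝ) x (h x)) U

/-- `h` is differentiable at `x` as a section of `T*M ⊗ T*M`. -/
def DiffAt (h : Π x : M, Bil E x) (x : M) : Prop :=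
  MDifferentiableAt 𝓘(ℝ, E) (𝓘(ℝ, E).prod 𝓘(ℝ, E →L[ℝ] E →L[ℝ] ℝ))
    (fun x ↦ TotalSpace.mk' (E →L[ℝ] E →L[ℝ] ℝ) x (h x)) x

/-- A smooth (global) vector field. -/
def SmoothField (X : Π x : M, TangentSpace 𝓘(ℝ, E) x) : Prop :=
  ContMDiff 𝓘(ℝ, E) (𝓘(ℝ, E).prod 𝓘(ℝ, E)) ∞ (fun x ↦ TotalSpace.mk' E x (X x))

/-- The expression `v (h (Y, Z)) - h (∇_v Y, Z) - h (Y, ∇_v Z)` at the point `x`. -/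
def covDerivAux (cov : CovariantDerivative 𝓘(ℝ, E) E (TangentSpace 𝓘(ℝ, E) : M → Type _))
    (h : Π x : M, Bil E x) (x : M) (v : TangentSpace 𝓘(ℝ, E) x)
    (Y Z : Π x : M, TangentSpace 𝓘(ℝ, E) x) : ℝ :=
  mvfderiv 𝓘(ℝ, E) (fun p ↦ h p (Y p) (Z p)) x v
    - h x (cov Y x v) (Z x) - h x (Y x) (cov Z x v)

theorem mdifferentiableAt_apply {h : Π x : M, Bil E x} {x : M} (hh : DiffAt h x)
    {Y Z : Π x : M, TangentSpace 𝓘(ℝ, E) x} (hY : MDiffAt (T% Y) x) (hZ : MDiffAt (T% Z) x) :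
    MDiffAt (fun p ↦ h p (Y p) (Z p)) x := by
  have : MDifferentiableAt 𝓘(ℝ, E) (𝓘(ℝ, E).prod 𝓘(ℝ, ℝ))
      (fun m ↦ TotalSpace.mk' ℝ (E := Bundle.Trivial M ℝ) m (h m (Y m) (Z m))) x :=
    MDifferentiableAt.clm_bundle_apply₂ (F₁ := E) (F₂ := E)
      (E₃ := Bundle.Trivial M ℝ) hh hY hZ
  simp only [mdifferentiableAt_totalSpace] at this
  exact this.2

theorem tensorial₁ (cov : CovariantDerivative 𝓘(ℝ, E) E (TangentSpace 𝓘(ℝ, E) : M → Type _))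
    {h : Π x : M, Bil E x} {x : M} (hh : DiffAt h x) (v : TangentSpace 𝓘(ℝ, E) x)
    (Z : Π x : M, TangentSpace 𝓘(ℝ, E) x) (hZ : MDiffAt (T% Z) x) :
    TensorialAt 𝓘(ℝ, E) E (covDerivAux cov h x v · Z) x where
  smul {f Y} hf hY := by
    have h1 := mvfderiv_fun_mul hf (mdifferentiableAt_apply hh hY hZ)
    have h2 := cov.isCovariantDerivativeOn.leibniz hY hf (s := Set.univ)
    simp only [covDerivAux, Pi.smul_apply', ContinuousLinearMap.map_smul,
      ContinuousLinearMap.map_add, smul_apply, add_apply,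
      ContinuousLinearMap.smulRight_apply, smul_eq_mul, h1, h2]
    ring
  add {Y Y'} hY hY' := by
    have h1 := mvfderiv_fun_add (mdifferentiableAt_apply hh hY hZ)
      (mdifferentiableAt_apply hh hY' hZ)
    have h2 := cov.isCovariantDerivativeOn.add hY hY' (s := Set.univ)
    simp only [covDerivAux, Pi.add_apply, ContinuousLinearMap.map_add, add_apply, h1, h2]
    ring

theorem tensorial₂ (cov : CovariantDerivative 𝓘(ℝ, E) E (TangentSpace 𝓘(ℝ, E) : M → Type _))
    {h : Π x : M, Bil E x} {x : M} (hh : DiffAt h x) (v : TangentSpace 𝓘(ℝ, E) x)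
    (Y : Π x : M, TangentSpace 𝓘(ℝ, E) x) (hY : MDiffAt (T% Y) x) :
    TensorialAt 𝓘(ℝ, E) E (covDerivAux cov h x v Y ·) x where
  smul {f Z} hf hZ := by
    have h1 := mvfderiv_fun_mul hf (mdifferentiableAt_apply hh hY hZ)
    have h2 := cov.isCovariantDerivativeOn.leibniz hZ hf (s := Set.univ)
    simp only [covDerivAux, Pi.smul_apply', ContinuousLinearMap.map_smul,
      ContinuousLinearMap.map_add, smul_apply, add_apply,
      ContinuousLinearMap.smulRight_apply, smul_eq_mul, h1, h2]
    ring
  add {Z Z'} hZ hZ' := by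
    have h1 := mvfderiv_fun_add (mdifferentiableAt_apply hh hY hZ)
      (mdifferentiableAt_apply hh hY hZ')
    have h2 := cov.isCovariantDerivativeOn.add hZ hZ' (s := Set.univ)
    simp only [covDerivAux, Pi.add_apply, ContinuousLinearMap.map_add, add_apply, h1, h2]
    ring

variable [FiniteDimensional ℝ E]

open Classical in
/-- The covariant derivative `∇_v h` at `x` of a section `h` of `T*M ⊗ T*M`, for the connection
induced by the connection `cov` on `TM`; it is the bilinear form
`(Y, Z) ↦ v (h (Y, Z)) - h (∇_v Y, Z) - h (Y, ∇_v Z)` (see `covDeriv_apply`).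
The value is `0` by convention if `h` is not differentiable at `x`. -/
def covDeriv (cov : CovariantDerivative 𝓘(ℝ, E) E (TangentSpace 𝓘(ℝ, E) : M → Type _))
    (h : Π x : M, Bil E x) (x : M) (v : TangentSpace 𝓘(ℝ, E) x) : Bil E x :=
  if hh : DiffAt h x then
    TensorialAt.mkHom₂ (covDerivAux cov h x v) x (tensorial₁ cov hh v) (tensorial₂ cov hh v)
  else 0

theorem covDeriv_apply
    (cov : CovariantDerivative 𝓘(ℝ, E) E (TangentSpace 𝓘(ℝ, E) : M → Type _))
    {h : Π x : M, Bil E x} {x : M} (hh : DiffAt h x) (v : TangentSpace 𝓘(ℝ, E) x)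
    {Y Z : Π x : M, TangentSpace 𝓘(ℝ, E) x} (hY : MDiffAt (T% Y) x) (hZ : MDiffAt (T% Z) x) :
    covDeriv cov h x v (Y x) (Z x) =
      mvfderiv 𝓘(ℝ, E) (fun p ↦ h p (Y p) (Z p)) x v
        - h x (cov Y x v) (Z x) - h x (Y x) (cov Z x v) := by
  rw [covDeriv, dif_pos hh]
  exact TensorialAt.mkHom₂_apply _ _ hY hZ

/-- `(R(X, Y) h)(x) = (∇_X ∇_Y h - ∇_Y ∇_X h - ∇_{[X, Y]} h)(x)`, the curvature of the induced
connection. -/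
def curvature (cov : CovariantDerivative 𝓘(ℝ, E) E (TangentSpace 𝓘(ℝ, E) : M → Type _))
    (X Y : Π x : M, TangentSpace 𝓘(ℝ, E) x) (h : Π x : M, Bil E x) (x : M) : Bil E x :=
  covDeriv cov (fun p ↦ covDeriv cov h p (Y p)) x (X x)
    - covDeriv cov (fun p ↦ covDeriv cov h p (X p)) x (Y x)
    - covDeriv cov h x (VectorField.mlieBracket 𝓘(ℝ, E) X Y x)

/-! ### The derived flag

`W` is the bundle of symmetric elements of `T*M ⊗ T*M`. A subset of `W` is given by its fibres. -/

/-- The fibre at `x` of the bundle `W` of symmetric covariant two-tensors. -/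
def symFibre (x : M) : Set (Bil E x) := {w | ∀ y z, w y z = w z y}

/-- The elements of `V` through which there is a smooth local section of `W` with values
in `V`. -/
def sectionPart (V : Π x : M, Set (Bil E x)) (x : M) : Set (Bil E x) :=
  {w | ∃ (U : Set M) (h : Π x : M, Bil E x), IsOpen U ∧ x ∈ U ∧ SmoothOn h U ∧
    (∀ p ∈ U, h p ∈ V p) ∧ h x = w}

/-- `{w ∈ W | R( , )(w) = 0}`. As `R` is a tensor, `R(X, Y) h` at `x` depends on `h` only through
`h x = w`, so that any smooth local section `h` of `W` through `w` may be used. -/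
def curvatureKernel
    (cov : CovariantDerivative 𝓘(ℝ, E) E (TangentSpace 𝓘(ℝ, E) : M → Type _))
    (x : M) : Set (Bil E x) :=
  {w | ∃ (U : Set M) (h : Π x : M, Bil E x), IsOpen U ∧ x ∈ U ∧ SmoothOn h U ∧
    (∀ p ∈ U, h p ∈ symFibre p) ∧ h x = w ∧
    ∀ X Y : Π x : M, TangentSpace 𝓘(ℝ, E) x, SmoothField X → SmoothField Y →
      curvature cov X Y h x = 0}

/-- The kernel of the second fundamental 1-form `W' → (W / W') ⊗ T*M` of `W'`, which sends `w` to
the class of `∇ h` at `x`, where `h` is any smooth local section of `W'` through `w`. -/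
def sffKernel
    (cov : CovariantDerivative 𝓘(ℝ, E) E (TangentSpace 𝓘(ℝ, E) : M → Type _))
    (W' : Π x : M, Set (Bil E x)) (x : M) : Set (Bil E x) :=
  {w | ∃ (U : Set M) (h : Π x : M, Bil E x), IsOpen U ∧ x ∈ U ∧ SmoothOn h U ∧
    (∀ p ∈ U, h p ∈ W' p) ∧ h x = w ∧ ∀ v, covDeriv cov h x v ∈ W' x}

/-- The derived flag `W⁽⁰⁾ ⊇ W⁽¹⁾ ⊇ ⋯`. -/
def flag (cov : CovariantDerivative 𝓘(ℝ, E) E (TangentSpace 𝓘(ℝ, E) : M → Type _)) :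
    ℕ → Π x : M, Set (Bil E x)
  | 0 => sectionPart (curvatureKernel cov)
  | i + 1 => sectionPart (sffKernel cov (flag cov i))

/-- The maximal flat subset `W̃` of `W`: the terminal term of the (decreasing) flag, that is, the
intersection of its terms. -/
def maximalFlat (cov : CovariantDerivative 𝓘(ℝ, E) E (TangentSpace 𝓘(ℝ, E) : M → Type _))
    (x : M) : Set (Bil E x) :=
  ⋂ i : ℕ, flag cov i x

/-- The subset `V` is a vector bundle of rank `n` over `M`: near each point it has a smooth
frame with `n` elements. -/
def IsSubbundleOfRank (V : Π x : M, Set (Bil E x)) (n : ℕ) : Prop :=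
  ∀ x₀ : M, ∃ (U : Set M) (X : Fin n → Π x : M, Bil E x), IsOpen U ∧ x₀ ∈ U ∧
    (∀ i, SmoothOn (X i) U) ∧
    ∀ p ∈ U, LinearIndependent ℝ (fun i ↦ X i p) ∧
      V p = (Submodule.span ℝ (Set.range fun i ↦ X i p) : Set (Bil E p))

/-- The connection is regular and `W̃` has rank `n`. -/
def IsRegularOfRank (cov : CovariantDerivative 𝓘(ℝ, E) E (TangentSpace 𝓘(ℝ, E) : M → Type _))
    (n : ℕ) : Prop :=
  IsSubbundleOfRank (maximalFlat cov) n

/-! ### Parallel metrics -/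

/-- Positive-definite symmetric bilinear forms. -/
def IsPosDef {x : M} (w : Bil E x) : Prop :=
  w ∈ symFibre x ∧ ∀ y, y ≠ 0 → 0 < w y y

/-- `g` restricts to a (smooth Riemannian) metric on `U` that is parallel. -/
def IsParallelMetricOn
    (cov : CovariantDerivative 𝓘(ℝ, E) E (TangentSpace 𝓘(ℝ, E) : M → Type _))
    (g : Π x : M, Bil E x) (U : Set M) : Prop :=
  SmoothOn g U ∧ (∀ x ∈ U, IsPosDef (g x)) ∧ ∀ x ∈ U, ∀ v, covDeriv cov g x v = 0

/-- The connection is locally metric: each point has an open neighbourhood with a parallel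
metric. -/
def IsLocallyMetric
    (cov : CovariantDerivative 𝓘(ℝ, E) E (TangentSpace 𝓘(ℝ, E) : M → Type _)) : Prop :=
  ∀ x : M, ∃ (U : Set M) (g : Π x : M, Bil E x), IsOpen U ∧ x ∈ U ∧ IsParallelMetricOn cov g U

/-- The connection is metric: there is a parallel metric on `M`. -/
def IsMetric
    (cov : CovariantDerivative 𝓘(ℝ, E) E (TangentSpace 𝓘(ℝ, E) : M → Type _)) : Prop :=
  ∃ g : Π x : M, Bil E x, IsParallelMetricOn cov g Set.univ

/-- `s` is a global smooth section of `W̃⁺`, the set of positive-definite elements of `W̃`. -/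
def IsPositiveSection
    (cov : CovariantDerivative 𝓘(ℝ, E) E (TangentSpace 𝓘(ℝ, E) : M → Type _))
    (s : Π x : M, Bil E x) : Prop :=
  SmoothOn s Set.univ ∧ ∀ x, s x ∈ maximalFlat cov x ∧ IsPosDef (s x)

end Tensors

/-! ### First de Rham cohomology -/

section DeRham

variable (E : Type*) [NormedAddCommGroup E] [NormedSpace ℝ E]
  (M : Type*) [TopologicalSpace M] [ChartedSpace E M] [IsManifold 𝓘(ℝ, E) ∞ M]

/-- Smooth 1-forms on `M`. -/
abbrev OneForm : Type _ :=
  Cₛ^∞⟮𝓘(ℝ, E); E →L[ℝ] ℝ, fun x : M ↦ (TangentSpace 𝓘(ℝ, E) x →L[ℝ] ℝ)⟯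

variable {E M}

/-- The exterior derivative of a 1-form, evaluated on two vector fields:
`dΦ (X, Y) = X (Φ Y) - Y (Φ X) - Φ [X, Y]`. -/
def extDerivOneForm (Φ : OneForm E M) (X Y : Π x : M, TangentSpace 𝓘(ℝ, E) x) (x : M) : ℝ :=
  mvfderiv 𝓘(ℝ, E) (fun p ↦ Φ p (Y p)) x (X x) - mvfderiv 𝓘(ℝ, E) (fun p ↦ Φ p (X p)) x (Y x)
    - Φ x (VectorField.mlieBracket 𝓘(ℝ, E) X Y x)

theorem mdifferentiableAt_oneForm_apply (Φ : OneForm E M) {X : Π x : M, TangentSpace 𝓘(ℝ, E) x}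
    (hX : SmoothField X) (x : M) : MDiffAt (fun p ↦ Φ p (X p)) x := by
  have : MDifferentiableAt 𝓘(ℝ, E) (𝓘(ℝ, E).prod 𝓘(ℝ, ℝ))
      (fun m ↦ TotalSpace.mk' ℝ (E := Bundle.Trivial M ℝ) m (Φ m (X m))) x :=
    MDifferentiableAt.clm_bundle_apply (F₁ := E) (Φ.contMDiff.mdifferentiableAt (by simp))
      (hX.mdifferentiableAt (by simp))
  simp only [mdifferentiableAt_totalSpace] at this
  exact this.2

variable (E M)

/-- The space of closed smooth 1-forms. -/
def closedOneForms : Submodule ℝ (OneForm E M) where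
  carrier := {Φ | ∀ X Y : Π x : M, TangentSpace 𝓘(ℝ, E) x, SmoothField X → SmoothField Y →
    ∀ x, extDerivOneForm Φ X Y x = 0}
  add_mem' {Φ Ψ} hΦ hΨ X Y hX hY x := by
    have h1 := hΦ X Y hX hY x
    have h2 := hΨ X Y hX hY x
    simp only [extDerivOneForm, ContMDiffSection.coe_add, Pi.add_apply,
      add_apply] at h1 h2 ⊢
    rw [mvfderiv_fun_add (mdifferentiableAt_oneForm_apply Φ hY x)
        (mdifferentiableAt_oneForm_apply Ψ hY x),
      mvfderiv_fun_add (mdifferentiableAt_oneForm_apply Φ hX x)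
        (mdifferentiableAt_oneForm_apply Ψ hX x)]
    simp only [add_apply]
    linarith
  zero_mem' X Y hX hY x := by
    simp [extDerivOneForm, mvfderiv_const]
  smul_mem' c Φ hΦ X Y hX hY x := by
    have h1 := hΦ X Y hX hY x
    simp only [extDerivOneForm, ContMDiffSection.coe_smul, Pi.smul_apply,
      smul_apply, smul_eq_mul] at h1 ⊢
    rw [mvfderiv_fun_mul mdifferentiableAt_const (mdifferentiableAt_oneForm_apply Φ hY x),
      mvfderiv_fun_mul mdifferentiableAt_const (mdifferentiableAt_oneForm_apply Φ hX x)]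
    simp [mvfderiv_const]
    linear_combination c * h1

/-- The space of exact smooth 1-forms: the differentials of smooth functions. -/
def exactOneForms : Submodule ℝ (OneForm E M) where
  carrier := {Φ | ∃ f : M → ℝ, ContMDiff 𝓘(ℝ, E) 𝓘(ℝ, ℝ) ∞ f ∧
    ∀ x, Φ x = mvfderiv 𝓘(ℝ, E) f x}
  add_mem' := by
    rintro Φ Ψ ⟨f, hf, hΦ⟩ ⟨g, hg, hΨ⟩
    refine ⟨f + g, hf.add hg, fun x ↦ ?_⟩
    rw [mvfderiv_add (hf.mdifferentiableAt (by simp)) (hg.mdifferentiableAt (by simp))]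
    simp [hΦ, hΨ]
  zero_mem' := ⟨fun _ ↦ 0, contMDiff_const, fun x ↦ by simp [mvfderiv_const]⟩
  smul_mem' := by
    rintro c Φ ⟨f, hf, hΦ⟩
    refine ⟨fun p ↦ c * f p, contMDiff_const.mul hf, fun x ↦ ?_⟩
    rw [mvfderiv_fun_mul mdifferentiableAt_const (hf.mdifferentiableAt (by simp))]
    simp [hΦ, mvfderiv_const]

/-- The first de Rham cohomology of `M`: closed 1-forms modulo exact 1-forms. -/
abbrev DeRhamH1 : Type _ :=
  closedOneForms E M ⧸ (exactOneForms E M).comap (closedOneForms E M).subtype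

variable {E M}

/-- The cohomology class of a closed 1-form. -/
def deRhamClass (Φ : closedOneForms E M) : DeRhamH1 E M :=
  Submodule.Quotient.mk Φ

/-- `∇ s = s ⊗ Φ`. -/
def NablaEq [FiniteDimensional ℝ E]
    (cov : CovariantDerivative 𝓘(ℝ, E) E (TangentSpace 𝓘(ℝ, E) : M → Type _))
    (s : Π x : M, Bil E x) (Φ : OneForm E M) : Prop :=
  ∀ (x : M) (v : TangentSpace 𝓘(ℝ, E) x), covDeriv cov s x v = Φ x v • s x

end DeRham

end MetricConnection

end

/-! A parallel section of `W` is annihilated by the curvature and by every second fundamental form,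
so it takes values in all terms of the flag (`mem_flag_of_parallel`). Local parallel metrics are
therefore local positive sections of `W̃`. Its positive-definite elements form a convex set in each
fibre, and a partition of unity yields a global `s`.

In rank one, two positive sections differ by a factor `exp u` with `u` smooth
(`exists_smooth_eq_exp_smul`). Against a local parallel metric, `s = exp u • g` gives `∇ s = s ⊗
du`. Since `s` vanishes nowhere, these local forms `du` agree on overlaps and glue to `Φ`, which is
closed because it is locally exact.

Rescaling `s` by `exp u` adds `du` to `Φ`, so the class is independent of `s`. A global parallel
metric is a positive section with form `0`; conversely, if `Φ = du`, then `exp (-u) • s` is a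
parallel metric. -/

noncomputable section

namespace MetricConnection

open Filter Topology FiberBundle VectorField

/-! ### Differentials of functions and the Lie bracket -/

section Functions

variable {E : Type*} [NormedAddCommGroup E] [NormedSpace ℝ E]
  {M : Type*} [TopologicalSpace M] [ChartedSpace E M]

theorem mvfderiv_congr {f g : M → ℝ} {x : M} (h : f =ᶠ[𝓝 x] g) :
    mvfderiv 𝓘(ℝ, E) f x = mvfderiv 𝓘(ℝ, E) g x := by
  ext v
  exact DFunLike.congr_fun h.mfderiv_eq v

theorem mvfderiv_exp {f : M → ℝ} {x : M} (hf : MDiffAt f x) (v : TangentSpace 𝓘(ℝ, E) x) :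
    mvfderiv 𝓘(ℝ, E) (fun p ↦ Real.exp (f p)) x v
      = Real.exp (f x) * mvfderiv 𝓘(ℝ, E) f x v := by
  have h := mvfderiv_comp_apply (I := 𝓘(ℝ, ℝ)) (g := Real.exp) x
    Real.differentiableAt_exp.mdifferentiableAt hf v
  rw [show (fun p ↦ Real.exp (f p)) = Real.exp ∘ f from rfl, h]
  have hexp : ∀ w : ℝ, fderiv ℝ Real.exp (f x) w = Real.exp (f x) * w := fun w ↦ by
    simp [fderiv_eq_smul_deriv, mul_comm]
  rw [mvfderiv, mfderiv_eq_fderiv]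
  exact hexp _

variable [IsManifold 𝓘(ℝ, E) ∞ M]

theorem contMDiffAt_mvfderiv {f : M → ℝ} {x : M} (hf : ContMDiffAt 𝓘(ℝ, E) 𝓘(ℝ, ℝ) ∞ f x) :
    ContMDiffAt 𝓘(ℝ, E) (𝓘(ℝ, E).prod 𝓘(ℝ, E →L[ℝ] ℝ)) ∞
      (fun p ↦ TotalSpace.mk' (E →L[ℝ] ℝ)
        (E := fun x : M ↦ (TangentSpace 𝓘(ℝ, E) x →L[ℝ] ℝ)) p (mvfderiv 𝓘(ℝ, E) f p)) x := by
  have h := hf.mfderiv_const (m := ∞) (by simp)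
  refine (contMDiffAt_hom_bundle (E₁ := fun x : M ↦ TangentSpace 𝓘(ℝ, E) x)
    (E₂ := Bundle.Trivial M ℝ) _).2 ⟨contMDiffAt_id, ?_⟩
  refine h.congr_of_eventuallyEq (Eventually.of_forall fun p ↦ ?_)
  ext v
  simp [inTangentCoordinates, ContinuousLinearMap.inCoordinates]
  rfl

theorem contMDiffAt_mvfderiv_apply {f : M → ℝ} {x : M} {X : Π x : M, TangentSpace 𝓘(ℝ, E) x}
    (hf : ContMDiffAt 𝓘(ℝ, E) 𝓘(ℝ, ℝ) ∞ f x)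
    (hX : ContMDiffAt 𝓘(ℝ, E) (𝓘(ℝ, E).prod 𝓘(ℝ, E)) ∞ (fun x ↦ TotalSpace.mk' E x (X x)) x) :
    ContMDiffAt 𝓘(ℝ, E) 𝓘(ℝ, ℝ) ∞ (fun p ↦ mvfderiv 𝓘(ℝ, E) f p (X p)) x := by
  have := ContMDiffAt.clm_bundle_apply (F₁ := E) (F₂ := ℝ) (E₂ := Bundle.Trivial M ℝ)
    (contMDiffAt_mvfderiv hf) hX
  exact (contMDiffAt_totalSpace.1 this).2

variable [FiniteDimensional ℝ E]

/-- The Lie bracket acts on functions as the commutator. -/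
theorem mvfderiv_mlieBracket {f : M → ℝ} {x : M} {X Y : Π x : M, TangentSpace 𝓘(ℝ, E) x}
    (hf : ContMDiffAt 𝓘(ℝ, E) 𝓘(ℝ, ℝ) ∞ f x)
    (hX : ContMDiffAt 𝓘(ℝ, E) (𝓘(ℝ, E).prod 𝓘(ℝ, E)) ∞ (fun x ↦ TotalSpace.mk' E x (X x)) x)
    (hY : ContMDiffAt 𝓘(ℝ, E) (𝓘(ℝ, E).prod 𝓘(ℝ, E)) ∞ (fun x ↦ TotalSpace.mk' E x (Y x)) x) :
    mvfderiv 𝓘(ℝ, E) f x (mlieBracket 𝓘(ℝ, E) X Y x)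
      = mvfderiv 𝓘(ℝ, E) (fun p ↦ mvfderiv 𝓘(ℝ, E) f p (Y p)) x (X x)
        - mvfderiv 𝓘(ℝ, E) (fun p ↦ mvfderiv 𝓘(ℝ, E) f p (X p)) x (Y x) := by
  have : IsManifold 𝓘(ℝ, E) (minSmoothness ℝ 3) M := by
    rw [minSmoothness_of_isRCLikeNormedField]
    exact IsManifold.of_le (n := ∞) (WithTop.coe_le_coe.2 (le_top : (3 : ℕ∞) ≤ ⊤))
  have : IsManifold 𝓘(ℝ, E) (((⊤ : ℕ∞) : WithTop ℕ∞) + 1) M := ‹IsManifold 𝓘(ℝ, E) ∞ M›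
  have two_le : minSmoothness ℝ 2 ≤ (∞ : WithTop ℕ∞) := by
    rw [minSmoothness_of_isRCLikeNormedField]
    exact WithTop.coe_le_coe.2 (le_top : (2 : ℕ∞) ≤ ⊤)
  -- The Jacobi identity for `X`, `Y`, `f • Z` is expanded by the Leibniz rule. Subtracting `f`
  -- times the identity for `X`, `Y`, `Z` and cancelling the mixed terms `X(f) [Y, Z]` and `Y(f) [X,
  -- Z]` leaves the commutator formula multiplied by `Z`.
  have key : ∀ z : TangentSpace 𝓘(ℝ, E) x,
      mvfderiv 𝓘(ℝ, E) f x (mlieBracket 𝓘(ℝ, E) X Y x) • z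
      = mvfderiv 𝓘(ℝ, E) (fun p ↦ mvfderiv 𝓘(ℝ, E) f p (Y p)) x (X x) • z
        - mvfderiv 𝓘(ℝ, E) (fun p ↦ mvfderiv 𝓘(ℝ, E) f p (X p)) x (Y x) • z := by
    intro z
    set Z := extend E z
    have hZ : ContMDiffAt 𝓘(ℝ, E) (𝓘(ℝ, E).prod 𝓘(ℝ, E)) ∞
      (fun x ↦ TotalSpace.mk' E x (Z x)) x := contMDiffAt_extend 𝓘(ℝ, E) E z
    have br : ∀ {A B : Π x : M, TangentSpace 𝓘(ℝ, E) x},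
      ContMDiffAt 𝓘(ℝ, E) (𝓘(ℝ, E).prod 𝓘(ℝ, E)) ∞ (fun x ↦ TotalSpace.mk' E x (A x)) x →
      ContMDiffAt 𝓘(ℝ, E) (𝓘(ℝ, E).prod 𝓘(ℝ, E)) ∞ (fun x ↦ TotalSpace.mk' E x (B x)) x →
      ContMDiffAt 𝓘(ℝ, E) (𝓘(ℝ, E).prod 𝓘(ℝ, E)) ∞
        (fun x ↦ TotalSpace.mk' E x (mlieBracket 𝓘(ℝ, E) A B x)) x := fun hA hB ↦
      ContMDiffAt.mlieBracket_vectorField (n := ⊤) (m := ⊤) hA hB (by simp)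
    have second : ∀ {A B : Π x : M, TangentSpace 𝓘(ℝ, E) x},
      ContMDiffAt 𝓘(ℝ, E) (𝓘(ℝ, E).prod 𝓘(ℝ, E)) ∞ (fun x ↦ TotalSpace.mk' E x (A x)) x →
      ContMDiffAt 𝓘(ℝ, E) (𝓘(ℝ, E).prod 𝓘(ℝ, E)) ∞ (fun x ↦ TotalSpace.mk' E x (B x)) x →
      mlieBracket 𝓘(ℝ, E) A (mlieBracket 𝓘(ℝ, E) B (f • Z)) x =
        (mvfderiv 𝓘(ℝ, E) (fun p ↦ mvfderiv 𝓘(ℝ, E) f p (B p)) x (A x) • Z x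
         + mvfderiv 𝓘(ℝ, E) f x (B x) • mlieBracket 𝓘(ℝ, E) A Z x)
        + (mvfderiv 𝓘(ℝ, E) f x (A x) • mlieBracket 𝓘(ℝ, E) B Z x
         + f x • mlieBracket 𝓘(ℝ, E) A (mlieBracket 𝓘(ℝ, E) B Z) x) := by
      intro A B hA hB
      have e : mlieBracket 𝓘(ℝ, E) B (f • Z) =ᶠ[𝓝 x]
          (fun p ↦ mvfderiv 𝓘(ℝ, E) f p (B p)) • Z + f • mlieBracket 𝓘(ℝ, E) B Z := by
        filter_upwards [(contMDiffAt_iff_contMDiffAt_nhds (by simp)).1 (hf.of_le (m := 1) (by simp)),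
          (contMDiffAt_iff_contMDiffAt_nhds (by simp)).1 (hZ.of_le (m := 1) (by simp))] with p hp hp'
        exact mlieBracket_smul_right (hp.mdifferentiableAt (by simp))
          (hp'.mdifferentiableAt (by simp))
      have hfB := contMDiffAt_mvfderiv_apply hf hB
      rw [EventuallyEq.rfl.mlieBracket_vectorField_eq e,
        mlieBracket_add_right
          ((hfB.smul_section hZ).mdifferentiableAt (by simp))
          ((hf.smul_section (br hB hZ)).mdifferentiableAt (by simp)),
        mlieBracket_smul_right (hfB.mdifferentiableAt (by simp)) (hZ.mdifferentiableAt (by simp)),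
        mlieBracket_smul_right (hf.mdifferentiableAt (by simp))
          ((br hB hZ).mdifferentiableAt (by simp))]
    have j := leibniz_identity_mlieBracket_apply (hX.of_le two_le) (hY.of_le two_le)
      ((hf.smul_section hZ).of_le two_le)
    have j' := leibniz_identity_mlieBracket_apply (hX.of_le two_le) (hY.of_le two_le)
      (hZ.of_le two_le)
    rw [second hX hY, second hY hX, mlieBracket_smul_right (hf.mdifferentiableAt (by simp))
      (hZ.mdifferentiableAt (by simp)), j'] at j
    have hz : Z x = z := extend_apply_self E z
    rw [hz] at j
    simp only [smul_add] at j
    have alg : ∀ {a b c d e l m : TangentSpace 𝓘(ℝ, E) x},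
        a + b + (c + (d + e)) = l + d + (m + c + (b + e)) → l = a - m := by
      intro a b c d e l m h
      calc l = l + d + (m + c + (b + e)) - (m + b + c + d + e) := by abel
        _ = a - m := by rw [← h]; abel
    exact alg j
  by_cases h : ∃ z : TangentSpace 𝓘(ℝ, E) x, z ≠ 0
  · obtain ⟨z, hz⟩ := h
    have := key z
    rw [← sub_smul] at this
    exact smul_left_injective ℝ hz this
  -- If the tangent space is zero, no `z` can be cancelled, but all the vectors involved vanish.
  · push Not at h
    simp [h (mlieBracket 𝓘(ℝ, E) X Y x), h (X x), h (Y x)]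

end Functions

/-! ### The induced connection on two-tensors and parallel sections -/

section CovDeriv

variable {E : Type*} [NormedAddCommGroup E] [NormedSpace ℝ E]
  {M : Type*} [TopologicalSpace M] [ChartedSpace E M] [IsManifold 𝓘(ℝ, E) ∞ M]

theorem mdifferentiableAt_extend_tangent {x : M} (y : TangentSpace 𝓘(ℝ, E) x) :
    MDiffAt (T% (extend E y : Π x : M, TangentSpace 𝓘(ℝ, E) x)) x :=
  mdifferentiableAt_extend 𝓘(ℝ, E) E y

theorem SmoothOn.diffAt {h : Π x : M, Bil E x} {U : Set M} (hh : SmoothOn h U) (hU : IsOpen U)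
    {x : M} (hx : x ∈ U) : DiffAt h x :=
  (hh.contMDiffAt (hU.mem_nhds hx)).mdifferentiableAt (by simp)

theorem DiffAt.congr {h h' : Π x : M, Bil E x} {x : M} (hh : DiffAt h x) (e : ∀ᶠ p in 𝓝 x, h' p = h p) :
    DiffAt h' x :=
  MDifferentiableAt.congr_of_eventuallyEq hh (e.mono fun p hp ↦ by simp [hp])

theorem smoothOn_zero (U : Set M) : SmoothOn (fun x : M ↦ (0 : Bil E x)) U :=
  (contMDiff_zeroSection ℝ (fun x : M ↦ Bil E x)).contMDiffOn

theorem contMDiffAt_apply {h : Π x : M, Bil E x} {U : Set M} (hh : SmoothOn h U) (hU : IsOpen U)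
    {x : M} (hx : x ∈ U) {Y Z : Π x : M, TangentSpace 𝓘(ℝ, E) x}
    (hY : ContMDiffAt 𝓘(ℝ, E) (𝓘(ℝ, E).prod 𝓘(ℝ, E)) ∞ (fun x ↦ TotalSpace.mk' E x (Y x)) x)
    (hZ : ContMDiffAt 𝓘(ℝ, E) (𝓘(ℝ, E).prod 𝓘(ℝ, E)) ∞ (fun x ↦ TotalSpace.mk' E x (Z x)) x) :
    ContMDiffAt 𝓘(ℝ, E) 𝓘(ℝ, ℝ) ∞ (fun p ↦ h p (Y p) (Z p)) x :=
  (contMDiffAt_totalSpace.1 (ContMDiffAt.clm_bundle_apply₂ (F₁ := E) (F₂ := E)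
    (E₃ := Bundle.Trivial M ℝ) (hh.contMDiffAt (hU.mem_nhds hx)) hY hZ)).2

variable [FiniteDimensional ℝ E]
  {cov : CovariantDerivative 𝓘(ℝ, E) E (TangentSpace 𝓘(ℝ, E) : M → Type _)}

theorem covDeriv_eq_of_forall {h : Π x : M, Bil E x} {x : M} (hh : DiffAt h x)
    {v : TangentSpace 𝓘(ℝ, E) x} {B : Bil E x}
    (H : ∀ Y Z : Π x : M, TangentSpace 𝓘(ℝ, E) x, MDiffAt (T% Y) x → MDiffAt (T% Z) x →
      covDerivAux cov h x v Y Z = B (Y x) (Z x)) :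
    covDeriv cov h x v = B := by
  ext y z
  have hY := mdifferentiableAt_extend_tangent y
  have hZ := mdifferentiableAt_extend_tangent z
  have h1 := covDeriv_apply cov hh v hY hZ
  have h2 := H _ _ hY hZ
  rw [covDerivAux] at h2
  rw [h2] at h1
  simpa only [extend_apply_self] using h1

theorem covDeriv_congr {h h' : Π x : M, Bil E x} {x : M} (e : ∀ᶠ p in 𝓝 x, h p = h' p)
    (v : TangentSpace 𝓘(ℝ, E) x) : covDeriv cov h x v = covDeriv cov h' x v := by
  have e' : ∀ᶠ p in 𝓝 x, h' p = h p := e.mono fun _ ↦ Eq.symm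
  by_cases hh : DiffAt h x
  · refine covDeriv_eq_of_forall hh fun Y Z hY hZ ↦ ?_
    rw [covDeriv_apply cov (hh.congr e') v hY hZ, covDerivAux, e.self_of_nhds,
      mvfderiv_congr (g := fun p ↦ h' p (Y p) (Z p)) (e.mono fun p hp ↦ by simp only [hp])]
  -- Differentiability depends only on the germ, so here both sides are the default value `0`.
  · have hh' : ¬ DiffAt h' x := fun H ↦ hh (H.congr e)
    rw [covDeriv, covDeriv, dif_neg hh, dif_neg hh']

theorem covDeriv_zero (x : M) (v : TangentSpace 𝓘(ℝ, E) x) :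
    covDeriv cov (fun _ ↦ 0) x v = 0 :=
  covDeriv_eq_of_forall ((smoothOn_zero Set.univ).diffAt isOpen_univ trivial) fun Y Z _ _ ↦ by
    simp [covDerivAux, mvfderiv_const]

theorem covDeriv_exp_smul {s : Π x : M, Bil E x} {u : M → ℝ} {x : M} (hs : DiffAt s x)
    (hu : MDiffAt u x) (v : TangentSpace 𝓘(ℝ, E) x) :
    covDeriv cov (fun p ↦ Real.exp (u p) • s p) x v
      = Real.exp (u x) • (covDeriv cov s x v + mvfderiv 𝓘(ℝ, E) u x v • s x) := by
  have he : MDiffAt (fun p ↦ Real.exp (u p)) x :=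
    (Real.differentiableAt_exp (x := u x)).mdifferentiableAt.comp x hu
  have hd : DiffAt (fun p ↦ Real.exp (u p) • s p) x := MDifferentiableAt.smul_section he hs
  refine covDeriv_eq_of_forall hd fun Y Z hY hZ ↦ ?_
  have h1 := mvfderiv_fun_mul he (mdifferentiableAt_apply hs hY hZ)
  simp only [covDerivAux, smul_apply, add_apply, smul_eq_mul, h1, covDeriv_apply cov hs v hY hZ,
    mvfderiv_exp hu]
  ring

/-- A parallel local section of `W` takes its values in each term of the derived flag. -/
theorem mem_flag_of_parallel {h : Π x : M, Bil E x} {U : Set M} (hU : IsOpen U)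
    (hh : SmoothOn h U) (hsym : ∀ x ∈ U, h x ∈ symFibre x)
    (hpar : ∀ x ∈ U, ∀ v, covDeriv cov h x v = 0) (i : ℕ) :
    ∀ x ∈ U, h x ∈ flag cov i x := by
  -- At each stage `h` itself serves as the local section. The induction is over all parallel
  -- sections because the next step also uses it for the zero section.
  induction i generalizing h U with
  | zero =>
    refine fun x hx ↦ ⟨U, h, hU, hx, hh, fun p hp ↦ ⟨U, h, hU, hp, hh, hsym, rfl, ?_⟩, rfl⟩
    intro X Y _ _
    have key (X Y : Π x : M, TangentSpace 𝓘(ℝ, E) x) :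
        covDeriv cov (fun q ↦ covDeriv cov h q (Y q)) p (X p) = 0 := by
      rw [covDeriv_congr (h' := fun _ ↦ 0), covDeriv_zero]
      filter_upwards [hU.mem_nhds hp] with q hq using hpar q hq _
    rw [curvature, key, key, hpar p hp]
    ext y z
    change (0 : ℝ) - 0 - 0 = 0
    simp
  | succ i ih =>
    -- Membership in `sffKernel` asks that `∇ h = 0` lie in the previous term. That term is not
    -- known to be linear, but the zero section is parallel.
    have hzero (x : M) : (0 : Bil E x) ∈ flag cov i x :=
      ih (h := fun _ ↦ 0) isOpen_univ (smoothOn_zero _) (fun _ _ _ _ ↦ rfl)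
        (fun x _ v ↦ covDeriv_zero x v) x trivial
    refine fun x hx ↦ ⟨U, h, hU, hx, hh, fun p hp ↦
      ⟨U, h, hU, hp, hh, ih hU hh hsym hpar, rfl, fun v ↦ ?_⟩, rfl⟩
    rw [hpar p hp]
    exact hzero p

theorem IsParallelMetricOn.mem_maximalFlat {g : Π x : M, Bil E x} {U : Set M}
    (hg : IsParallelMetricOn cov g U) (hU : IsOpen U) {x : M} (hx : x ∈ U) :
    g x ∈ maximalFlat cov x :=
  Set.mem_iInter.2 fun i ↦
    mem_flag_of_parallel hU hg.1 (fun x hx ↦ (hg.2.1 x hx).1) hg.2.2 i x hx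

/-! ### Positive-definite elements of the rank-one bundle -/

omit [FiniteDimensional ℝ E] [IsManifold 𝓘(ℝ, E) ∞ M] in
theorem convex_isPosDef (x : M) : Convex ℝ {w : Bil E x | IsPosDef w} := by
  intro w hw w' hw' a b ha hb hab
  refine ⟨fun y z ↦ ?_, fun y hy ↦ ?_⟩
  · simp [hw.1 y z, hw'.1 y z]
  · have h1 := hw.2 y hy
    have h2 := hw'.2 y hy
    simp only [add_apply, smul_apply, smul_eq_mul]
    rcases ha.lt_or_eq with h | h
    · have := mul_pos h h1
      have := mul_nonneg hb h2.le
      linarith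
    · subst h
      simp only [zero_add] at hab
      simpa [hab] using h2

theorem convex_maximalFlat (hreg : IsRegularOfRank cov 1) (x : M) :
    Convex ℝ (maximalFlat cov x) := by
  obtain ⟨U, X, -, hx, -, H⟩ := hreg x
  rw [(H x hx).2]
  exact Submodule.convex _

/-- On a zero tangent space every bilinear form vanishes, which contradicts the nonzero frame
element. Without such a vector, positive-definiteness would be vacuous and would not exclude the
zero form. -/
theorem exists_tangent_ne_zero (hreg : IsRegularOfRank cov 1) (x : M) :
    ∃ y : TangentSpace 𝓘(ℝ, E) x, y ≠ 0 := by
  obtain ⟨U, X, -, hx, -, H⟩ := hreg x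
  by_contra! h
  refine (H x hx).1.ne_zero 0 ?_
  ext y
  simp [h y]

theorem exists_eq_exp_smul (hreg : IsRegularOfRank cov 1) {x : M} {w w' : Bil E x}
    (hw : w ∈ maximalFlat cov x) (hw' : w' ∈ maximalFlat cov x) (hpos : IsPosDef w)
    (hpos' : IsPosDef w') : ∃ c : ℝ, w' = Real.exp c • w := by
  obtain ⟨U, X, -, hx, -, H⟩ := hreg x
  have hs : Set.range (fun i ↦ X i x) = {X 0 x} := by
    ext; simp [Fin.exists_fin_one, eq_comm]
  rw [(H x hx).2, hs, SetLike.mem_coe, Submodule.mem_span_singleton] at hw hw'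
  obtain ⟨a, rfl⟩ := hw
  obtain ⟨b, rfl⟩ := hw'
  obtain ⟨y, hy⟩ := exists_tangent_ne_zero hreg x
  have h1 := hpos.2 y hy
  have h2 := hpos'.2 y hy
  simp only [smul_apply, smul_eq_mul] at h1 h2
  have ha : a ≠ 0 := by rintro rfl; simp at h1
  -- With `w` and `w'` equal to `a` and `b` times the frame element, the ratio `b / a` is positive:
  -- it equals `w' y y / w y y`.
  refine ⟨Real.log (b / a), ?_⟩
  have hba : 0 < b / a := by
    rw [← mul_div_mul_right b a (c := X 0 x y y) (by rintro h; simp [h] at h1)]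
    exact div_pos h2 h1
  rw [Real.exp_log hba, smul_smul, div_mul_cancel₀ _ ha]

theorem exists_smooth_eq_exp_smul (hreg : IsRegularOfRank cov 1) {U : Set M} (hU : IsOpen U)
    {s s' : Π x : M, Bil E x} (hs : SmoothOn s U) (hs' : SmoothOn s' U)
    (hf : ∀ x ∈ U, s x ∈ maximalFlat cov x ∧ IsPosDef (s x))
    (hf' : ∀ x ∈ U, s' x ∈ maximalFlat cov x ∧ IsPosDef (s' x)) :
    ∃ u : M → ℝ, ContMDiffOn 𝓘(ℝ, E) 𝓘(ℝ, ℝ) ∞ u U ∧ ∀ x ∈ U, s' x = Real.exp (u x) • s x := by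
  choose! u hu using fun x (hx : x ∈ U) ↦
    exists_eq_exp_smul hreg (hf x hx).1 (hf' x hx).1 (hf x hx).2 (hf' x hx).2
  refine ⟨u, fun x hx ↦ ContMDiffAt.contMDiffWithinAt ?_, hu⟩
  obtain ⟨y, hy⟩ := exists_tangent_ne_zero hreg x
  set Y : Π x : M, TangentSpace 𝓘(ℝ, E) x := extend E y
  have hY : ContMDiffAt 𝓘(ℝ, E) (𝓘(ℝ, E).prod 𝓘(ℝ, E)) ∞
    (fun x ↦ TotalSpace.mk' E x (Y x)) x := contMDiffAt_extend 𝓘(ℝ, E) E y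
  have hYx : Y x ≠ 0 := by simpa [Y] using hy
  have c := contMDiffAt_apply hs hU hx hY hY
  have c' := contMDiffAt_apply hs' hU hx hY hY
  have p := (hf x hx).2.2 _ hYx
  have p' := (hf' x hx).2.2 _ hYx
  have l := (Real.contDiffAt_log.2 p.ne').contMDiffAt.comp (n := ∞) x c
  have l' := (Real.contDiffAt_log.2 p'.ne').contMDiffAt.comp (n := ∞) x c'
  -- The pointwise choice `u` is forced near `x`: it is `log (s' Y Y) - log (s Y Y)` wherever `s Y Y
  -- ≠ 0`, a neighbourhood of `x` by continuity.
  refine (l'.sub l).congr_of_eventuallyEq ?_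
  filter_upwards [hU.mem_nhds hx, c.continuousAt.eventually_ne p.ne'] with q hq hne
  simp only [Function.comp, hu q hq, smul_apply, smul_eq_mul]
  rw [Real.log_mul (Real.exp_ne_zero _) hne, Real.log_exp]
  ring

/-- Near each point, a positive section `s` of the maximal flat subset satisfies
`∇ s = s ⊗ du` for a smooth function `u`. -/
theorem IsPositiveSection.exists_local_potential (hreg : IsRegularOfRank cov 1)
    (hloc : IsLocallyMetric cov) {s : Π x : M, Bil E x} (hs : IsPositiveSection cov s) (x₀ : M) :
    ∃ (U : Set M) (u : M → ℝ), IsOpen U ∧ x₀ ∈ U ∧ ContMDiffOn 𝓘(ℝ, E) 𝓘(ℝ, ℝ) ∞ u U ∧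
      ∀ x ∈ U, ∀ v, covDeriv cov s x v = mvfderiv 𝓘(ℝ, E) u x v • s x := by
  obtain ⟨U, g, hU, hx₀, hg⟩ := hloc x₀
  -- The potential is the logarithm of `s` relative to a local parallel metric `g`.
  obtain ⟨u, hu, hsu⟩ := exists_smooth_eq_exp_smul hreg hU hg.1 (hs.1.mono (Set.subset_univ U))
    (fun x hx ↦ ⟨hg.mem_maximalFlat hU hx, hg.2.1 x hx⟩) (fun x _ ↦ hs.2 x)
  refine ⟨U, u, hU, hx₀, hu, fun x hx v ↦ ?_⟩
  rw [covDeriv_congr (h' := fun p ↦ Real.exp (u p) • g p)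
      (by filter_upwards [hU.mem_nhds hx] with p hp using hsu p hp),
    covDeriv_exp_smul (hg.1.diffAt hU hx)
      ((hu.contMDiffAt (hU.mem_nhds hx)).mdifferentiableAt (by simp)),
    hg.2.2 x hx, hsu x hx]
  ext y z
  simp only [smul_apply, add_apply, zero_apply, smul_eq_mul]
  ring

-- Convex combinations stay in `W̃` and stay positive-definite, so a partition of unity glues the
-- local parallel metrics. The result need not be parallel.
set_option maxHeartbeats 2000000 in
set_option synthInstance.maxHeartbeats 400000 in
theorem exists_isPositiveSection [T2Space M] [SigmaCompactSpace M] (hreg : IsRegularOfRank cov 1)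
    (hloc : IsLocallyMetric cov) : ∃ s : Π x : M, Bil E x, IsPositiveSection cov s := by
  obtain ⟨s, hs⟩ := exists_contMDiffSection_forall_mem_convex_of_local (n := ⊤) 𝓘(ℝ, E)
    (F_fiber := E →L[ℝ] E →L[ℝ] ℝ) (fun x : M ↦ Bil E x)
    (fun x ↦ maximalFlat cov x ∩ {w | IsPosDef w})
    (fun x ↦ (convex_maximalFlat hreg x).inter (convex_isPosDef x)) (fun x₀ ↦ by
      obtain ⟨U, g, hU, hx₀, hg⟩ := hloc x₀
      exact ⟨U, hU.mem_nhds hx₀, g, hg.1, fun y hy ↦ ⟨hg.mem_maximalFlat hU hy, hg.2.1 y hy⟩⟩)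
  exact ⟨s, s.contMDiff.contMDiffOn, hs⟩

end CovDeriv

/-! ### The connection form and its cohomology class -/

section Forms

variable {E : Type*} [NormedAddCommGroup E] [NormedSpace ℝ E] [FiniteDimensional ℝ E]
  {M : Type*} [TopologicalSpace M] [ChartedSpace E M] [IsManifold 𝓘(ℝ, E) ∞ M]
  {cov : CovariantDerivative 𝓘(ℝ, E) E (TangentSpace 𝓘(ℝ, E) : M → Type _)}

theorem IsPositiveSection.smul_left_injective (hreg : IsRegularOfRank cov 1)
    {s : Π x : M, Bil E x} (hs : IsPositiveSection cov s) {x : M} {a b : ℝ}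
    (h : a • s x = b • s x) : a = b := by
  obtain ⟨y, hy⟩ := exists_tangent_ne_zero hreg x
  have h' := congr($h y y)
  simp only [smul_apply, smul_eq_mul] at h'
  exact mul_right_cancel₀ ((hs.2 x).2.2 y hy).ne' h'

theorem NablaEq.eq_of_covDeriv_eq (hreg : IsRegularOfRank cov 1) {s : Π x : M, Bil E x}
    (hs : IsPositiveSection cov s) {Φ : OneForm E M} (hΦ : NablaEq cov s Φ) {x : M}
    {φ : TangentSpace 𝓘(ℝ, E) x →L[ℝ] ℝ} (h : ∀ v, covDeriv cov s x v = φ v • s x) : Φ x = φ := by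
  ext v
  exact hs.smul_left_injective hreg ((hΦ x v).symm.trans (h v))

theorem existsUnique_nablaEq (hreg : IsRegularOfRank cov 1) (hloc : IsLocallyMetric cov)
    {s : Π x : M, Bil E x} (hs : IsPositiveSection cov s) :
    ∃! Φ : OneForm E M, NablaEq cov s Φ := by
  choose U u hU hxU hu hsu using hs.exists_local_potential hreg hloc
  -- At `x` the form uses the potential chosen for `x` itself. Near `x₀` it agrees with the
  -- differential of the single function `u x₀`, since both multiply the nonzero `s` to the same
  -- covariant derivative; this gives smoothness.
  refine ⟨⟨fun x ↦ mvfderiv 𝓘(ℝ, E) (u x) x, fun x₀ ↦ ?_⟩, fun x v ↦ hsu x x (hxU x) v,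
    fun Φ hΦ ↦ ContMDiffSection.ext fun x ↦ hΦ.eq_of_covDeriv_eq hreg hs (hsu x x (hxU x))⟩
  refine (contMDiffAt_mvfderiv
    ((hu x₀).contMDiffAt ((hU x₀).mem_nhds (hxU x₀)))).congr_of_eventuallyEq ?_
  filter_upwards [(hU x₀).mem_nhds (hxU x₀)] with x hx
  congr 1
  ext v
  exact hs.smul_left_injective hreg
    ((hsu x x (hxU x) v).symm.trans (hsu x₀ x hx v))

theorem NablaEq.mem_closedOneForms (hreg : IsRegularOfRank cov 1) (hloc : IsLocallyMetric cov)
    {s : Π x : M, Bil E x} (hs : IsPositiveSection cov s) {Φ : OneForm E M}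
    (hΦ : NablaEq cov s Φ) : Φ ∈ closedOneForms E M := by
  intro X Y hX hY x
  obtain ⟨U, u, hU, hx, hu, hsu⟩ := hs.exists_local_potential hreg hloc x
  have e (p) (hp : p ∈ U) : Φ p = mvfderiv 𝓘(ℝ, E) u p :=
    hΦ.eq_of_covDeriv_eq hreg hs (hsu p hp)
  have e' (Z : Π x : M, TangentSpace 𝓘(ℝ, E) x) :
      (fun p ↦ Φ p (Z p)) =ᶠ[𝓝 x] fun p ↦ mvfderiv 𝓘(ℝ, E) u p (Z p) := by
    filter_upwards [hU.mem_nhds hx] with p hp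
    rw [e p hp]
  -- With `Φ = du` near `x`, closedness is the commutator formula for `[X, Y]` acting on `u`.
  rw [extDerivOneForm, mvfderiv_congr (e' Y), mvfderiv_congr (e' X), e x hx,
    mvfderiv_mlieBracket (hu.contMDiffAt (hU.mem_nhds hx)) (hX x) (hY x), sub_self]

/-- Rescaling a section by `exp u` changes its connection form by `du`. -/
theorem NablaEq.eq_add_mvfderiv (hreg : IsRegularOfRank cov 1) {s s' : Π x : M, Bil E x}
    (hs : IsPositiveSection cov s) (hs' : IsPositiveSection cov s') {Φ Φ' : OneForm E M}
    (hΦ : NablaEq cov s Φ) (hΦ' : NablaEq cov s' Φ') {u : M → ℝ}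
    (hu : ContMDiff 𝓘(ℝ, E) 𝓘(ℝ, ℝ) ∞ u) (hsu : ∀ x, s' x = Real.exp (u x) • s x) (x : M) :
    Φ' x = Φ x + mvfderiv 𝓘(ℝ, E) u x := by
  refine hΦ'.eq_of_covDeriv_eq hreg hs' fun v ↦ ?_
  rw [funext hsu, covDeriv_exp_smul (hs.1.diffAt isOpen_univ trivial)
    (hu.mdifferentiableAt (by simp)), hΦ x v]
  ext y z
  simp only [smul_apply, add_apply, smul_eq_mul]
  ring

theorem deRhamClass_eq_of_nablaEq (hreg : IsRegularOfRank cov 1) {s s' : Π x : M, Bil E x}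
    {Φ Φ' : closedOneForms E M}
    (hs : IsPositiveSection cov s) (hΦ : NablaEq cov s Φ)
    (hs' : IsPositiveSection cov s') (hΦ' : NablaEq cov s' Φ') :
    deRhamClass Φ = deRhamClass Φ' := by
  -- Writing `s = exp u • s'`, in this order, makes `Φ - Φ'` equal to `du` without a sign.
  obtain ⟨u, hu, hsu⟩ := exists_smooth_eq_exp_smul hreg isOpen_univ hs'.1 hs.1
    (fun x _ ↦ hs'.2 x) (fun x _ ↦ hs.2 x)
  refine (Submodule.Quotient.eq _).2 ⟨u, contMDiffOn_univ.1 hu, fun x ↦ ?_⟩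
  have := NablaEq.eq_add_mvfderiv hreg hs' hs hΦ' hΦ (contMDiffOn_univ.1 hu)
    (fun x ↦ hsu x trivial) x
  change (Φ : OneForm E M) x - (Φ' : OneForm E M) x = _
  rw [this, add_sub_cancel_left]

theorem isMetric_iff_deRhamClass_eq_zero (hreg : IsRegularOfRank cov 1)
    {s : Π x : M, Bil E x} (hs : IsPositiveSection cov s) {Φ : closedOneForms E M}
    (hΦ : NablaEq cov s Φ) : IsMetric cov ↔ deRhamClass Φ = 0 := by
  constructor
  · rintro ⟨g, hg⟩
    have hgs : IsPositiveSection cov g :=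
      ⟨hg.1, fun x ↦ ⟨hg.mem_maximalFlat isOpen_univ trivial, hg.2.1 x trivial⟩⟩
    -- The parallel metric is a positive section with connection form `0`, and the class does not
    -- depend on the section.
    rw [deRhamClass_eq_of_nablaEq hreg hs hΦ hgs (Φ' := 0) fun x v ↦ ?_]
    · rfl
    · rw [hg.2.2 x trivial v]
      ext y z
      exact (zero_mul (g x y z)).symm
  · intro h
    obtain ⟨u, hu, hΦu⟩ := (Submodule.Quotient.mk_eq_zero _).1 h
    have hΦu (x : M) : (Φ : OneForm E M) x = mvfderiv 𝓘(ℝ, E) u x := hΦu x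
    have hu' : ContMDiff 𝓘(ℝ, E) 𝓘(ℝ, ℝ) ∞ (fun x ↦ - u x) := hu.neg
    have he : ContMDiff 𝓘(ℝ, E) 𝓘(ℝ, ℝ) ∞ (fun x ↦ Real.exp (- u x)) :=
      Real.contDiff_exp.contMDiff.comp hu'
    -- The factor `exp (-u)` contributes `-du`, which cancels `Φ = du`.
    refine ⟨fun x ↦ Real.exp (- u x) • s x, he.contMDiffOn.smul_section hs.1, fun x _ ↦ ⟨?_, ?_⟩,
      fun x _ v ↦ ?_⟩
    · intro y z
      simp [(hs.2 x).2.1 y z]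
    · intro y hy
      exact mul_pos (Real.exp_pos _) ((hs.2 x).2.2 y hy)
    · rw [covDeriv_exp_smul (hs.1.diffAt isOpen_univ trivial) (hu'.mdifferentiableAt (by simp)),
        hΦ x v, hΦu x, mvfderiv_fun_neg]
      ext y z
      simp only [smul_apply, add_apply, neg_apply, zero_apply, smul_eq_mul]
      ring

end Forms

end MetricConnection

end

theorem theorem2 {E : Type*} [NormedAddCommGroup E] [NormedSpace ℝ E] [FiniteDimensional ℝ E]
    {M : Type*} [TopologicalSpace M] [ChartedSpace E M] [IsManifold 𝓘(ℝ, E) ∞ M]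
    [T2Space M] [SigmaCompactSpace M] [ConnectedSpace M]
    (cov : CovariantDerivative 𝓘(ℝ, E) E (TangentSpace 𝓘(ℝ, E) : M → Type _))
    (hsmooth : CovariantDerivative.ContMDiffCovariantDerivative cov ∞)
    (hreg : MetricConnection.IsRegularOfRank cov 1)
    (hloc : MetricConnection.IsLocallyMetric cov) :
    (∃ s : Π x : M, MetricConnection.Bil E x, MetricConnection.IsPositiveSection cov s) ∧
    (∀ s : Π x : M, MetricConnection.Bil E x, MetricConnection.IsPositiveSection cov s →
      ∃! Φ : MetricConnection.OneForm E M, MetricConnection.NablaEq cov s Φ) ∧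
    (∀ (s : Π x : M, MetricConnection.Bil E x) (Φ : MetricConnection.OneForm E M),
      MetricConnection.IsPositiveSection cov s → MetricConnection.NablaEq cov s Φ →
      ∃ hΦ : Φ ∈ MetricConnection.closedOneForms E M,
        (MetricConnection.IsMetric cov ↔ MetricConnection.deRhamClass ⟨Φ, hΦ⟩ = 0)) ∧
    (∀ (s s' : Π x : M, MetricConnection.Bil E x)
      (Φ Φ' : MetricConnection.closedOneForms E M),
      MetricConnection.IsPositiveSection cov s → MetricConnection.NablaEq cov s Φ →
      MetricConnection.IsPositiveSection cov s' → MetricConnection.NablaEq cov s' Φ' →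
      MetricConnection.deRhamClass Φ = MetricConnection.deRhamClass Φ') :=
  open MetricConnection in
  ⟨exists_isPositiveSection hreg hloc, fun _ hs ↦ existsUnique_nablaEq hreg hloc hs,
    fun _ _ hs hΦ ↦ ⟨hΦ.mem_closedOneForms hreg hloc hs,
      isMetric_iff_deRhamClass_eq_zero hreg hs hΦ⟩,
    fun _ _ _ _ hs hΦ hs' hΦ' ↦ deRhamClass_eq_of_nablaEq hreg hs hΦ hs' hΦ'⟩
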